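/- Let $K\ge 1$, $M\ge 1$, $N\ge 2$. Let $D\in\mathbb R^{M\times K}$ be a matrix whose columns $d_1,\dots,d_K$ lie in the probability simplex, i.e. $d_k\ge 0$ entrywise and $\sum_m D_{mk}=1$; let $c_1,\dots,c_K>0$ and $b>0$, and put $c_0=\sum_k c_k$ and $\bar c_0=\min(1,c_0)$. In the gamma–Poisson (GP) model, a document is a random count vector $x\in\mathbb N^M$ generated as follows: $\alpha_1,\dots,\alpha_K$ are independent with $\alpha_k\sim\mathrm{Gamma}(c_k,b)$ (shape $c_k$, rate $b$) and, given $\alpha$, the coordinates $x_1,\dots,x_M$ are independent with $x_m\sim\mathrm{Poisson}([D\alpha]_m)$. Let $L=\sum_m x_m$ be the document length, $\bar L=\mathbb E(L)$, $\Delta=\max_k\|d_k\|_2^2$, and let $S=\mathrm{Cov}(x,x)-\mathrm{diag}(\mathbb E(x))$ be the GP cumulant. For independent documents $x_1,\dots,x_N$ drawn from this model, let $$\widehat S=\widehat{\mathrm{Cov}}(x,x)-\mathrm{diag}(\widehat{\mathbb E}(x)),\qquad \widehat{\mathbb E}(x)=\frac1N\sum_n x_n,\qquad \widehat{\mathrm{Cov}}(x,x)=\frac1{N-1}\sum_n\bigl(x_n-\widehat{\mathbb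 E}(x)\bigr)\bigl(x_n-\widehat{\mathbb E}(x)\bigr)^{\top}.$$ Then $\widehat S$ is an unbiased estimator of $S$, $\|\widehat S-S\|_F^2$ is integrable, and $$\mathbb E\|\widehat S-S\|_F\;\le\;\sqrt{\mathbb E\|\widehat S-S\|_F^2}\;\le\;\frac{C}{\bar c_0^{\,3/2}}\cdot\frac{1}{\sqrt N}\,\max\bigl(\Delta\,\bar L^2,\ \bar c_0\,\bar L\bigr),$$ where $C>0$ is a universal constant. In particular, the right-hand side is $O\bigl(\tfrac1{\sqrt N}\max(\Delta\bar L^2,\bar c_0\bar L)\bigr)$ with an implied constant that depends only on $\bar c_0$ (and not on $N$, $M$, $K$, $D$, $b$). -/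

import Mathlib

open MeasureTheory ProbabilityTheory
open scoped Matrix.Norms.Frobenius

/-- The conditional law of a document `x ∈ ℕ^M` given the topic intensities `a`: the coordinates
are independent and `x_m` is Poisson with rate `[D a]_m`.  (The rate is truncated at `0`, which
plays no role for entrywise nonnegative `D` and `a`.) -/
noncomputable def gpConditional {M K : ℕ} (D : Matrix (Fin M) (Fin K) ℝ) (a : Fin K → ℝ) :
    Measure (Fin M → ℕ) :=
  Measure.pi fun m => poissonMeasure (Real.toNNReal (D.mulVec a m))

theorem measurable_gpConditional {M K : ℕ} (D : Matrix (Fin M) (Fin K) ℝ) :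
    Measurable (gpConditional D) := by
  refine Measure.measurable_of_measurable_coe _ fun s hs => ?_
  have h : ∀ a, gpConditional D a s = ∑' x : Fin M → ℕ,
      s.indicator (fun x => gpConditional D a {x}) x := fun a =>
    (Measure.tsum_indicator_apply_singleton _ s hs).symm
  simp_rw [h]
  refine Measurable.tsum fun x => ?_
  by_cases hx : x ∈ s
  · simp only [Set.indicator_of_mem hx, gpConditional, Measure.pi_singleton,
      poissonMeasure_singleton, Matrix.mulVec, dotProduct]
    fun_prop
  · simp [Set.indicator_of_notMem hx]

/-- `gpConditional` as a Markov kernel. -/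
noncomputable def gpKernel {M K : ℕ} (D : Matrix (Fin M) (Fin K) ℝ) :
    Kernel (Fin K → ℝ) (Fin M → ℕ) :=
  ⟨gpConditional D, measurable_gpConditional D⟩

/-- The law of one document in the gamma-Poisson model: the intensities `α_k` are independent
with law Gamma (shape `c_k`, rate `b`), and given `α` the counts `x_m` are independent
with law Poisson of rate `[D α]_m`. -/
noncomputable def gpLaw {M K : ℕ} (D : Matrix (Fin M) (Fin K) ℝ) (c : Fin K → ℝ) (b : ℝ) :
    Measure (Fin M → ℕ) :=
  Measure.bind (Measure.pi fun k => gammaMeasure (c k) b) (gpKernel D)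

/-- The expected document length `E(L)`, `L = ∑_m x_m`. -/
noncomputable def gpMeanLength {M K : ℕ} (D : Matrix (Fin M) (Fin K) ℝ) (c : Fin K → ℝ)
    (b : ℝ) : ℝ :=
  ∫ x, ∑ m, (x m : ℝ) ∂(gpLaw D c b)

/-- The GP cumulant `S = Cov(x, x) - diag(E x)`. -/
noncomputable def gpCumulant {M K : ℕ} (D : Matrix (Fin M) (Fin K) ℝ) (c : Fin K → ℝ)
    (b : ℝ) : Matrix (Fin M) (Fin M) ℝ :=
  (Matrix.of fun i j =>
      covariance (fun x : Fin M → ℕ => (x i : ℝ)) (fun x => (x j : ℝ)) (gpLaw D c b))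
    - Matrix.diagonal fun i => ∫ x, (x i : ℝ) ∂(gpLaw D c b)

/-- The sample mean `(1/N) ∑_n x_n`. -/
noncomputable def sampleMean {N M : ℕ} (X : Fin N → Fin M → ℕ) (i : Fin M) : ℝ :=
  (1 / (N : ℝ)) * ∑ n, (X n i : ℝ)

/-- The sample covariance matrix, normalized by `N - 1`. -/
noncomputable def sampleCov {N M : ℕ} (X : Fin N → Fin M → ℕ) : Matrix (Fin M) (Fin M) ℝ :=
  Matrix.of fun i j =>
    (1 / ((N : ℝ) - 1)) * ∑ n, ((X n i : ℝ) - sampleMean X i) * ((X n j : ℝ) - sampleMean X j)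

/-- The sample estimator of the GP cumulant, computed from the documents `X 0, …, X (N-1)`. -/
noncomputable def gpEstimator {N M : ℕ} (X : Fin N → Fin M → ℕ) : Matrix (Fin M) (Fin M) ℝ :=
  sampleCov X - Matrix.diagonal (sampleMean X)

/-- `Δ = max_k ‖d_k‖₂²`, where `d_k` is the `k`-th column of `D`. -/
noncomputable def maxTopicNormSq {M K : ℕ} (D : Matrix (Fin M) (Fin K) ℝ) : ℝ :=
  ⨆ k : Fin K, ‖WithLp.toLp 2 (D.col k)‖ ^ 2

/-- `c̄₀ = min(1, c₀)` with `c₀ = ∑_k c_k`. -/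
noncomputable def cappedShape {K : ℕ} (c : Fin K → ℝ) : ℝ :=
  min 1 (∑ k, c k)

/-! The estimator is a U-statistic: each entry is the average over ordered pairs of distinct
documents of `pairKernel` (`gpEstimator_apply_eq`). The kernel has mean `S i j`, which gives
unbiasedness, so the mean squared Frobenius error is the sum of the variances of the entries. Pairs
without a common document are uncorrelated, which leaves a variance of order `1/N` times second
moments of the kernel (`variance_sum_offDiag_le`, `variance_gpEstimator_le`). It remains to bound `∑
E (pairCount i j)²` and `(∑ E x_i²)²`.

Given `α`, put `λ = D α` and `A = ∑ α_k`. Poisson moments bound the conditional second moment of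
`pairCount i j` by `2 (λ_i² + λ_i)(λ_j² + λ_j)`, and `E (x_i² | α) = λ_i² + λ_i`. Since `∑ λ_i = A`
and `∑ λ_i² ≤ Δ A²`, the sum over words leaves only `Δ A² + A`, whatever `M` and `K` are. The
moments of `A` up to order four are those of Gamma(`c₀`, `b`). Relative to `L̄ = c₀ / b`, the fourth
one costs `(1 + 1/c₀)(1 + 2/c₀)(1 + 3/c₀)`, which is the source of `c̄₀⁻³` in the squared error
(`gamma_moment_bound`).

Subtracting the diagonal matters: `x_i (x_i - 1)` has a second moment that starts at `λ_i²`, whereas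
that of `x_i²` has a term linear in `λ_i`, which the claimed bound could not absorb for small `L̄`.
-/

open scoped ENNReal NNReal

/-! ### Poisson moments -/

/-- The Chen–Stein identity for the Poisson distribution. -/
theorem lintegral_natCast_mul_poissonMeasure (r : ℝ≥0) (g : ℕ → ℝ≥0∞) :
    ∫⁻ n, (n : ℝ≥0∞) * g n ∂poissonMeasure r = r * ∫⁻ n, g (n + 1) ∂poissonMeasure r := by
  rw [lintegral_countable', lintegral_countable', tsum_eq_zero_add' ENNReal.summable,
    ← ENNReal.tsum_mul_left]
  simp only [Nat.cast_zero, zero_mul, zero_add]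
  congr 1 with n
  rw [poissonMeasure_singleton, poissonMeasure_singleton]
  have h : ((n + 1 : ℕ) : ℝ≥0∞) * ENNReal.ofReal (Real.exp (-r) * r ^ (n + 1) / (n + 1).factorial)
      = r * ENNReal.ofReal (Real.exp (-r) * r ^ n / n.factorial) := by
    rw [← ENNReal.ofReal_natCast, ← ENNReal.ofReal_coe_nnreal, ← ENNReal.ofReal_mul (by positivity),
      ← ENNReal.ofReal_mul (by positivity)]
    congr 1
    rw [Nat.factorial_succ]
    push_cast
    field_simp
    ring
  rw [mul_right_comm, h]
  ring

theorem lintegral_natCast_poissonMeasure (r : ℝ≥0) :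
    ∫⁻ n, (n : ℝ≥0∞) ∂poissonMeasure r = r := by
  simpa using lintegral_natCast_mul_poissonMeasure r 1

theorem lintegral_natCast_sq_poissonMeasure (r : ℝ≥0) :
    ∫⁻ n, (n : ℝ≥0∞) ^ 2 ∂poissonMeasure r = r ^ 2 + r := by
  simp_rw [pow_two]
  rw [lintegral_natCast_mul_poissonMeasure]
  push_cast
  rw [lintegral_add_left .of_discrete, lintegral_natCast_poissonMeasure]
  simp [mul_add]

/-- Two Chen–Stein shifts absorb one factor `n` and one factor `n - 1`, leaving the mean of `(n +
2)(n + 1)`. The result has no term linear in `r`. -/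
theorem lintegral_natCast_mul_pred_sq_poissonMeasure (r : ℝ≥0) :
    ∫⁻ n, ((n * (n - 1) : ℕ) : ℝ≥0∞) ^ 2 ∂poissonMeasure r = r ^ 4 + 4 * r ^ 3 + 2 * r ^ 2 := by
  have h : ∀ n : ℕ, ((n * (n - 1) : ℕ) : ℝ≥0∞) ^ 2
      = n * ((n : ℝ≥0∞) * ((n - 1 : ℕ) : ℝ≥0∞) ^ 2) := fun n => by push_cast; ring
  have hshift₁ : ∀ n : ℕ, ((n + 1 : ℕ) : ℝ≥0∞) * ((n + 1 - 1 : ℕ) : ℝ≥0∞) ^ 2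
      = n * (((n + 1 : ℕ) : ℝ≥0∞) * n) := fun n => by rw [Nat.add_sub_cancel]; ring
  have hshift₂ : ∀ n : ℕ, ((n + 1 + 1 : ℕ) : ℝ≥0∞) * ((n + 1 : ℕ) : ℝ≥0∞)
      = (n : ℝ≥0∞) ^ 2 + (3 * n + 2) := fun n => by push_cast; ring
  simp_rw [h]
  rw [lintegral_natCast_mul_poissonMeasure]
  simp_rw [hshift₁]
  rw [lintegral_natCast_mul_poissonMeasure]
  simp_rw [hshift₂]
  rw [lintegral_add_left .of_discrete, lintegral_add_left .of_discrete,
    lintegral_const_mul _ .of_discrete, lintegral_natCast_poissonMeasure,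
    lintegral_natCast_sq_poissonMeasure]
  simp only [lintegral_const, measure_univ]
  ring

/-! ### Gamma moments and the total intensity -/

/-- Weighting the gamma distribution by its variable shifts the shape by one. -/
theorem lintegral_ofReal_mul_gammaMeasure {a r : ℝ} (ha : 0 < a) (hr : 0 < r) {g : ℝ → ℝ≥0∞}
    (hg : Measurable g) :
    ∫⁻ x, ENNReal.ofReal x * g x ∂gammaMeasure a r =
      ENNReal.ofReal (a / r) * ∫⁻ x, g x ∂gammaMeasure (a + 1) r := by
  have hm : ∀ a, Measurable (gammaPDF a r) := fun a => (measurable_gammaPDFReal a r).ennreal_ofReal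
  rw [gammaMeasure, gammaMeasure, lintegral_withDensity_eq_lintegral_mul _ (hm _) (by fun_prop),
    lintegral_withDensity_eq_lintegral_mul _ (hm _) hg, ← lintegral_const_mul _ ((hm _).mul hg)]
  congr 1 with x
  simp only [Pi.mul_apply]
  rw [← mul_assoc, ← mul_assoc]
  congr 1
  rcases le_or_gt 0 x with hx | hx
  · rw [gammaPDF_of_nonneg hx, gammaPDF_of_nonneg hx, ← ENNReal.ofReal_mul' hx,
      ← ENNReal.ofReal_mul (by positivity)]
    congr 1
    have hG := (Real.Gamma_pos_of_pos ha).ne'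
    rw [Real.Gamma_add_one ha.ne', Real.rpow_add_one hr.ne', add_sub_cancel_right]
    -- At `x = 0` the power `x ^ (a - 1)` cannot be written as `x ^ a / x`; there both sides vanish,
    -- the right one because `a > 0`.
    rcases hx.eq_or_lt with rfl | hx
    · simp [Real.zero_rpow ha.ne']
    · rw [Real.rpow_sub_one hx.ne']
      field_simp
  · simp [gammaPDF_of_neg hx]

theorem ae_nonneg_gammaMeasure (a r : ℝ) : ∀ᵐ x ∂gammaMeasure a r, 0 ≤ x := by
  rw [gammaMeasure, ae_withDensity_iff (f := gammaPDF a r) (measurable_gammaPDFReal a r).ennreal_ofReal]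
  refine ae_of_all _ fun x hx => ?_
  by_contra h
  exact hx (gammaPDF_of_neg (not_le.1 h))

/-- The first four moments of `X` are those of a gamma distribution of shape `c` and scale `s`. -/
structure HasGammaMoments {Ω : Type*} [MeasurableSpace Ω] (μ : Measure Ω) (X : Ω → ℝ≥0∞)
    (c s : ℝ≥0∞) : Prop where
  one : ∫⁻ ω, X ω ∂μ = s * c
  two : ∫⁻ ω, X ω ^ 2 ∂μ = s ^ 2 * (c * (c + 1))
  three : ∫⁻ ω, X ω ^ 3 ∂μ = s ^ 3 * (c * (c + 1) * (c + 2))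
  four : ∫⁻ ω, X ω ^ 4 ∂μ = s ^ 4 * (c * (c + 1) * (c + 2) * (c + 3))

theorem hasGammaMoments_gammaMeasure {a r : ℝ} (ha : 0 < a) (hr : 0 < r) :
    HasGammaMoments (gammaMeasure a r) ENNReal.ofReal (ENNReal.ofReal a)
      (ENNReal.ofReal r⁻¹) := by
  -- Each shift lowers the power by one and raises the shape by one, so iteration produces the
  -- rising factorial of the shape.
  have key : ∀ {a : ℝ}, 0 < a → ∀ p : ℕ, ∫⁻ x, ENNReal.ofReal x ^ (p + 1) ∂gammaMeasure a r =
      ENNReal.ofReal r⁻¹ * ENNReal.ofReal a * ∫⁻ x, ENNReal.ofReal x ^ p ∂gammaMeasure (a + 1) r := by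
    intro a ha p
    simp_rw [pow_succ']
    rw [lintegral_ofReal_mul_gammaMeasure ha hr (by fun_prop),
      ← ENNReal.ofReal_mul (by positivity), inv_mul_eq_div]
  have h0 : ∀ {a : ℝ}, 0 < a → ∫⁻ x, ENNReal.ofReal x ^ 0 ∂gammaMeasure a r = 1 := by
    intro a ha
    have := isProbabilityMeasure_gammaMeasure ha hr
    simp
  have e : ∀ {a : ℝ}, 0 < a → ENNReal.ofReal (a + 1) = ENNReal.ofReal a + 1 := fun ha => by
    rw [ENNReal.ofReal_add ha.le zero_le_one, ENNReal.ofReal_one]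
  have p1 := fun {a : ℝ} (ha : 0 < a) => key ha 0
  have p2 := fun {a : ℝ} (ha : 0 < a) => key ha 1
  have p3 := fun {a : ℝ} (ha : 0 < a) => key ha 2
  have p4 := fun {a : ℝ} (ha : 0 < a) => key ha 3
  have a1 : 0 < a + 1 := by positivity
  have a2 : 0 < a + 1 + 1 := by positivity
  have a3 : 0 < a + 1 + 1 + 1 := by positivity
  constructor
  · have := p1 ha
    rw [h0 a1] at this
    simpa using this
  · rw [p2 ha, p1 a1, h0 a2, e ha]; ring
  · rw [p3 ha, p2 a1, p1 a2, h0 a3, e a1, e ha]; ring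
  · rw [p4 ha, p3 a1, p2 a2, p1 a3, h0 (by positivity), e a2, e a1, e ha]; ring

theorem ProbabilityTheory.IndepFun.lintegral_pow_mul_pow {Ω : Type*} [MeasurableSpace Ω]
    {μ : Measure Ω} {X Y : Ω → ℝ≥0∞} (h : IndepFun X Y μ) (hX : Measurable X) (hY : Measurable Y)
    (p q : ℕ) :
    ∫⁻ ω, X ω ^ p * Y ω ^ q ∂μ = (∫⁻ ω, X ω ^ p ∂μ) * ∫⁻ ω, Y ω ^ q ∂μ :=
  lintegral_mul_eq_lintegral_mul_lintegral_of_indepFun (hX.pow_const p) (hY.pow_const q)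
    (h.comp (measurable_id.pow_const p) (measurable_id.pow_const q))

/-- Binomial expansion plus the Vandermonde identity for rising factorials. Additivity of the shape
at the level of moments avoids any convolution of densities. -/
theorem HasGammaMoments.add {Ω : Type*} [MeasurableSpace Ω] {μ : Measure Ω}
    {X Y : Ω → ℝ≥0∞} {c d s : ℝ≥0∞} (hX : HasGammaMoments μ X c s) (hY : HasGammaMoments μ Y d s)
    (h : IndepFun X Y μ) (mX : Measurable X) (mY : Measurable Y) :
    HasGammaMoments μ (X + Y) (c + d) s := by
  have H := fun p q => h.lintegral_pow_mul_pow mX mY p q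
  constructor
  · simp only [Pi.add_apply]
    rw [lintegral_add_left mX, hX.one, hY.one]
    ring
  · have e : ∀ ω, (X + Y) ω ^ 2 = X ω ^ 2 + (2 * (X ω ^ 1 * Y ω ^ 1) + Y ω ^ 2) := fun ω => by
      simp only [Pi.add_apply]; ring
    simp_rw [e]
    rw [lintegral_add_left (by fun_prop), lintegral_add_left (by fun_prop),
      lintegral_const_mul _ (by fun_prop), H, hX.two, hY.two]
    simp only [pow_one]
    rw [hX.one, hY.one]
    ring
  · have e : ∀ ω, (X + Y) ω ^ 3 =
        X ω ^ 3 + (3 * (X ω ^ 2 * Y ω ^ 1) + (3 * (X ω ^ 1 * Y ω ^ 2) + Y ω ^ 3)) := fun ω => by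
      simp only [Pi.add_apply]; ring
    simp_rw [e]
    rw [lintegral_add_left (by fun_prop), lintegral_add_left (by fun_prop),
      lintegral_add_left (by fun_prop), lintegral_const_mul _ (by fun_prop),
      lintegral_const_mul _ (by fun_prop), H, H, hX.two, hY.two, hX.three, hY.three]
    simp only [pow_one]
    rw [hX.one, hY.one]
    ring
  · have e : ∀ ω, (X + Y) ω ^ 4 = X ω ^ 4 + (4 * (X ω ^ 3 * Y ω ^ 1) +
        (6 * (X ω ^ 2 * Y ω ^ 2) + (4 * (X ω ^ 1 * Y ω ^ 3) + Y ω ^ 4))) := fun ω => by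
      simp only [Pi.add_apply]; ring
    simp_rw [e]
    rw [lintegral_add_left (by fun_prop), lintegral_add_left (by fun_prop),
      lintegral_add_left (by fun_prop), lintegral_add_left (by fun_prop),
      lintegral_const_mul _ (by fun_prop), lintegral_const_mul _ (by fun_prop),
      lintegral_const_mul _ (by fun_prop), H, H, H, hX.two, hY.two, hX.three, hY.three,
      hX.four, hY.four]
    simp only [pow_one]
    rw [hX.one, hY.one]
    ring

theorem HasGammaMoments.sum {Ω ι : Type*} [MeasurableSpace Ω] {μ : Measure Ω}
    {X : ι → Ω → ℝ≥0∞} {c : ι → ℝ≥0∞} {s : ℝ≥0∞} (hX : ∀ i, HasGammaMoments μ (X i) (c i) s)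
    (h : iIndepFun X μ) (mX : ∀ i, Measurable (X i)) (t : Finset ι) :
    HasGammaMoments μ (∑ i ∈ t, X i) (∑ i ∈ t, c i) s := by
  classical
  induction t using Finset.induction_on with
  | empty => constructor <;> simp
  | insert i t hi ih =>
    rw [Finset.sum_insert hi, Finset.sum_insert hi]
    exact (hX i).add ih (h.indepFun_finsetSum_of_notMem mX hi).symm (mX i)
      (by fun_prop)

/-- The total intensity `∑ k, α k` has gamma moments of shape `∑ k, c k`. -/
theorem hasGammaMoments_sum_pi {K : ℕ} {c : Fin K → ℝ} (hc : ∀ k, 0 < c k) {b : ℝ} (hb : 0 < b) :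
    HasGammaMoments (Measure.pi fun k => gammaMeasure (c k) b)
      (fun a => ∑ k, ENNReal.ofReal (a k)) (ENNReal.ofReal (∑ k, c k)) (ENNReal.ofReal b⁻¹) := by
  have := fun k => isProbabilityMeasure_gammaMeasure (hc k) hb
  have h1 : ∀ k, HasGammaMoments (Measure.pi fun k => gammaMeasure (c k) b)
      (fun a => ENNReal.ofReal (a k)) (ENNReal.ofReal (c k)) (ENNReal.ofReal b⁻¹) := by
    intro k
    have mp := measurePreserving_eval (fun k => gammaMeasure (c k) b) k
    have h := hasGammaMoments_gammaMeasure (hc k) hb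
    constructor
    · rw [← h.one, ← mp.lintegral_comp (by fun_prop)]
    · rw [← h.two, ← mp.lintegral_comp (by fun_prop)]
    · rw [← h.three, ← mp.lintegral_comp (by fun_prop)]
    · rw [← h.four, ← mp.lintegral_comp (by fun_prop)]
  have h2 : iIndepFun (fun k (a : Fin K → ℝ) => ENNReal.ofReal (a k))
      (Measure.pi fun k => gammaMeasure (c k) b) :=
    iIndepFun_pi (X := fun _ => ENNReal.ofReal) fun k => by fun_prop
  have h3 := HasGammaMoments.sum h1 h2 (fun k => by fun_prop) Finset.univ
  rw [ENNReal.ofReal_sum_of_nonneg fun k _ => (hc k).le]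
  convert h3 using 1
  ext a
  simp

/-! ### Moments of a document given the intensities -/

/-- The number of ordered pairs of distinct tokens in a document, the first being the word `i` and
the second the word `j`. -/
def pairCount {M : ℕ} (x : Fin M → ℕ) (i j : Fin M) : ℕ :=
  if i = j then x i * (x i - 1) else x i * x j

theorem natCast_pairCount {M : ℕ} (x : Fin M → ℕ) (i j : Fin M) :
    (pairCount x i j : ℝ) = x i * x j - if i = j then (x i : ℝ) else 0 := by
  unfold pairCount
  split_ifs with h
  · subst h
    rcases Nat.eq_zero_or_pos (x i) with h0 | h0
    · simp [h0]
    · push_cast [Nat.cast_sub h0]; ring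
  · simp

section Conditional

variable {M K : ℕ} (D : Matrix (Fin M) (Fin K) ℝ) (a : Fin K → ℝ)

instance : IsProbabilityMeasure (gpConditional D a) := by
  unfold gpConditional; infer_instance

theorem lintegral_eval_gpConditional (i : Fin M) (g : ℕ → ℝ≥0∞) :
    ∫⁻ x, g (x i) ∂gpConditional D a =
      ∫⁻ n, g n ∂poissonMeasure (Real.toNNReal (D.mulVec a i)) :=
  (measurePreserving_eval (fun m => poissonMeasure (Real.toNNReal (D.mulVec a m))) i).lintegral_comp
    .of_discrete

theorem lintegral_apply_gpConditional (i : Fin M) :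
    ∫⁻ x, (x i : ℝ≥0∞) ∂gpConditional D a = ENNReal.ofReal (D.mulVec a i) := by
  rw [lintegral_eval_gpConditional D a i (fun n => (n : ℝ≥0∞)), lintegral_natCast_poissonMeasure]
  rfl

theorem lintegral_apply_sq_gpConditional (i : Fin M) :
    ∫⁻ x, (x i : ℝ≥0∞) ^ 2 ∂gpConditional D a =
      ENNReal.ofReal (D.mulVec a i) ^ 2 + ENNReal.ofReal (D.mulVec a i) := by
  rw [lintegral_eval_gpConditional D a i (fun n => (n : ℝ≥0∞) ^ 2),
    lintegral_natCast_sq_poissonMeasure]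
  rfl

/-- Off the diagonal, independence gives the product exactly; the factor 2 is needed only for `i =
j`, where the slack is `r ^ 4`. The product form lets the double sum over words factor. -/
theorem lintegral_pairCount_sq_gpConditional_le (i j : Fin M) :
    ∫⁻ x, (pairCount x i j : ℝ≥0∞) ^ 2 ∂gpConditional D a ≤
      2 * ((ENNReal.ofReal (D.mulVec a i) ^ 2 + ENNReal.ofReal (D.mulVec a i)) *
        (ENNReal.ofReal (D.mulVec a j) ^ 2 + ENNReal.ofReal (D.mulVec a j))) := by
  by_cases h : i = j
  · subst h
    simp only [pairCount, if_true]
    rw [lintegral_eval_gpConditional D a i (fun n => ((n * (n - 1) : ℕ) : ℝ≥0∞) ^ 2),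
      lintegral_natCast_mul_pred_sq_poissonMeasure]
    change ENNReal.ofReal (D.mulVec a i) ^ 4 + 4 * ENNReal.ofReal (D.mulVec a i) ^ 3
      + 2 * ENNReal.ofReal (D.mulVec a i) ^ 2 ≤ _
    generalize ENNReal.ofReal (D.mulVec a i) = r
    calc r ^ 4 + 4 * r ^ 3 + 2 * r ^ 2 ≤ r ^ 4 + 4 * r ^ 3 + 2 * r ^ 2 + r ^ 4 := le_self_add
      _ = _ := by ring
  · simp only [pairCount, if_neg h]
    have hind : IndepFun (fun x : Fin M → ℕ => (x i : ℝ≥0∞)) (fun x => (x j : ℝ≥0∞))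
        (gpConditional D a) :=
      (iIndepFun_pi (μ := fun m => poissonMeasure (Real.toNNReal (D.mulVec a m)))
        (X := fun _ n => (n : ℝ≥0∞)) fun _ => Measurable.of_discrete.aemeasurable).indepFun h
    simp_rw [Nat.cast_mul, mul_pow]
    rw [hind.lintegral_pow_mul_pow .of_discrete .of_discrete, lintegral_apply_sq_gpConditional,
      lintegral_apply_sq_gpConditional, two_mul]
    exact le_self_add

end Conditional

/-! ### The mixed law of a document -/

section Law

variable {M K : ℕ} (D : Matrix (Fin M) (Fin K) ℝ) (c : Fin K → ℝ) (b : ℝ)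

theorem lintegral_gpLaw (f : (Fin M → ℕ) → ℝ≥0∞) :
    ∫⁻ x, f x ∂gpLaw D c b =
      ∫⁻ a, ∫⁻ x, f x ∂gpConditional D a ∂Measure.pi fun k => gammaMeasure (c k) b :=
  Measure.lintegral_bind (gpKernel D).aemeasurable Measurable.of_discrete.aemeasurable

theorem isProbabilityMeasure_gpLaw {c : Fin K → ℝ} (hc : ∀ k, 0 < c k) {b : ℝ} (hb : 0 < b) :
    IsProbabilityMeasure (gpLaw D c b) := by
  have := fun k => isProbabilityMeasure_gammaMeasure (hc k) hb
  constructor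
  rw [← lintegral_one, lintegral_gpLaw]
  simp

theorem ae_nonneg_pi_gammaMeasure {c : Fin K → ℝ} (hc : ∀ k, 0 < c k) {b : ℝ} (hb : 0 < b) :
    ∀ᵐ a ∂Measure.pi fun k => gammaMeasure (c k) b, ∀ k, 0 ≤ a k := by
  have := fun k => isProbabilityMeasure_gammaMeasure (hc k) hb
  refine ae_all_iff.2 fun k => ?_
  exact (measurePreserving_eval (fun k => gammaMeasure (c k) b) k).quasiMeasurePreserving.ae
    (ae_nonneg_gammaMeasure (c k) b)

end Law

/-! ### Summing the Poisson rates over words -/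

section Simplex

variable {M K : ℕ} {D : Matrix (Fin M) (Fin K) ℝ}
  {a : Fin K → ℝ}

theorem sum_mulVec_of_mem_stdSimplex (hD : ∀ k, D.col k ∈ stdSimplex ℝ (Fin M))
    (a : Fin K → ℝ) : ∑ m, D.mulVec a m = ∑ k, a k := by
  simp only [Matrix.mulVec, dotProduct]
  rw [Finset.sum_comm]
  refine Finset.sum_congr rfl fun k _ => ?_
  rw [← Finset.sum_mul]
  have := (hD k).2
  simp only [Matrix.col_apply] at this
  rw [this, one_mul]

theorem mulVec_nonneg_of_mem_stdSimplex (hD : ∀ k, D.col k ∈ stdSimplex ℝ (Fin M))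
    (ha : ∀ k, 0 ≤ a k) (m : Fin M) : 0 ≤ D.mulVec a m := by
  simp only [Matrix.mulVec, dotProduct]
  exact Finset.sum_nonneg fun k _ => mul_nonneg ((hD k).1 m) (ha k)

/-- Cauchy–Schwarz with weights `a k` in each row, followed by exchanging the sums so that the
squared column norms appear. -/
theorem sum_mulVec_sq_le (ha : ∀ k, 0 ≤ a k) :
    ∑ m, D.mulVec a m ^ 2 ≤ maxTopicNormSq D * (∑ k, a k) ^ 2 := by
  have h1 : ∀ m, D.mulVec a m ^ 2 ≤ (∑ k, a k) * ∑ k, a k * D m k ^ 2 := fun m => by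
    simp only [Matrix.mulVec, dotProduct]
    exact Finset.sum_sq_le_sum_mul_sum_of_sq_le_mul _ (fun k _ => ha k)
      (fun k _ => mul_nonneg (ha k) (sq_nonneg _)) fun k _ => le_of_eq (by ring)
  have h2 : ∀ k, ∑ m, D m k ^ 2 ≤ maxTopicNormSq D := fun k => by
    refine le_trans (le_of_eq ?_) (le_ciSup (Set.finite_range _).bddAbove k)
    rw [EuclideanSpace.real_norm_sq_eq]
    rfl
  calc ∑ m, D.mulVec a m ^ 2 ≤ ∑ m, (∑ k, a k) * ∑ k, a k * D m k ^ 2 :=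
        Finset.sum_le_sum fun m _ => h1 m
    _ = (∑ k, a k) * ∑ k, a k * ∑ m, D m k ^ 2 := by
        rw [← Finset.mul_sum, Finset.sum_comm]
        simp_rw [Finset.mul_sum]
    _ ≤ (∑ k, a k) * ∑ k, a k * maxTopicNormSq D := by
        gcongr with k
        · exact Finset.sum_nonneg fun k _ => ha k
        · exact ha k
        · exact h2 k
    _ = maxTopicNormSq D * (∑ k, a k) ^ 2 := by
        rw [← Finset.sum_mul]; ring

theorem sum_ofReal_mulVec (hD : ∀ k, D.col k ∈ stdSimplex ℝ (Fin M)) (ha : ∀ k, 0 ≤ a k) :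
    ∑ m, ENNReal.ofReal (D.mulVec a m) = ∑ k, ENNReal.ofReal (a k) := by
  rw [← ENNReal.ofReal_sum_of_nonneg fun m _ => mulVec_nonneg_of_mem_stdSimplex hD ha m,
    ← ENNReal.ofReal_sum_of_nonneg fun k _ => ha k, sum_mulVec_of_mem_stdSimplex hD]

theorem sum_ofReal_mulVec_sq_le (hD : ∀ k, D.col k ∈ stdSimplex ℝ (Fin M))
    (ha : ∀ k, 0 ≤ a k) : ∑ m, ENNReal.ofReal (D.mulVec a m) ^ 2 ≤
    ENNReal.ofReal (maxTopicNormSq D) * (∑ k, ENNReal.ofReal (a k)) ^ 2 := by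
  have hn := mulVec_nonneg_of_mem_stdSimplex hD ha
  rw [← ENNReal.ofReal_sum_of_nonneg fun k _ => ha k,
    ← ENNReal.ofReal_pow (Finset.sum_nonneg fun k _ => ha k), ← ENNReal.ofReal_mul' (by positivity)]
  simp_rw [← ENNReal.ofReal_pow (hn _)]
  rw [← ENNReal.ofReal_sum_of_nonneg fun m _ => sq_nonneg _]
  exact ENNReal.ofReal_le_ofReal (sum_mulVec_sq_le ha)

end Simplex

/-! ### Document moments summed over words -/

section LawMoments

variable {M K : ℕ} {D : Matrix (Fin M) (Fin K) ℝ} {c : Fin K → ℝ} {b : ℝ}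

theorem sum_lintegral_apply_gpLaw (hD : ∀ k, D.col k ∈ stdSimplex ℝ (Fin M))
    (hc : ∀ k, 0 < c k) (hb : 0 < b) :
    ∑ i, ∫⁻ x, (x i : ℝ≥0∞) ∂gpLaw D c b =
      ∫⁻ a, ∑ k, ENNReal.ofReal (a k) ∂Measure.pi fun k => gammaMeasure (c k) b := by
  rw [← lintegral_finsetSum _ fun i _ => .of_discrete, lintegral_gpLaw]
  refine lintegral_congr_ae ?_
  filter_upwards [ae_nonneg_pi_gammaMeasure hc hb] with a ha
  rw [lintegral_finsetSum _ fun i _ => .of_discrete, ← sum_ofReal_mulVec hD ha]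
  simp_rw [lintegral_apply_gpConditional]

theorem sum_lintegral_apply_sq_gpLaw_le (hD : ∀ k, D.col k ∈ stdSimplex ℝ (Fin M))
    (hc : ∀ k, 0 < c k) (hb : 0 < b) :
    ∑ i, ∫⁻ x, (x i : ℝ≥0∞) ^ 2 ∂gpLaw D c b ≤
      ∫⁻ a, (ENNReal.ofReal (maxTopicNormSq D) * (∑ k, ENNReal.ofReal (a k)) ^ 2
        + ∑ k, ENNReal.ofReal (a k)) ∂Measure.pi fun k => gammaMeasure (c k) b := by
  rw [← lintegral_finsetSum _ fun i _ => .of_discrete, lintegral_gpLaw]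
  refine lintegral_mono_ae ?_
  filter_upwards [ae_nonneg_pi_gammaMeasure hc hb] with a ha
  rw [lintegral_finsetSum _ fun i _ => .of_discrete]
  simp_rw [lintegral_apply_sq_gpConditional]
  rw [Finset.sum_add_distrib, sum_ofReal_mulVec hD ha]
  gcongr
  exact sum_ofReal_mulVec_sq_le hD ha

theorem sum_lintegral_pairCount_sq_gpLaw_le (hD : ∀ k, D.col k ∈ stdSimplex ℝ (Fin M))
    (hc : ∀ k, 0 < c k) (hb : 0 < b) :
    ∑ i, ∑ j, ∫⁻ x, (pairCount x i j : ℝ≥0∞) ^ 2 ∂gpLaw D c b ≤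
      ∫⁻ a, 2 * (ENNReal.ofReal (maxTopicNormSq D) * (∑ k, ENNReal.ofReal (a k)) ^ 2
        + ∑ k, ENNReal.ofReal (a k)) ^ 2 ∂Measure.pi fun k => gammaMeasure (c k) b := by
  simp_rw [← lintegral_finsetSum Finset.univ fun i _ => Measurable.of_discrete]
  rw [lintegral_gpLaw]
  refine lintegral_mono_ae ?_
  filter_upwards [ae_nonneg_pi_gammaMeasure hc hb] with a ha
  rw [lintegral_finsetSum _ fun i _ => .of_discrete]
  calc ∑ i, ∫⁻ x, ∑ j, (pairCount x i j : ℝ≥0∞) ^ 2 ∂gpConditional D a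
      = ∑ i, ∑ j, ∫⁻ x, (pairCount x i j : ℝ≥0∞) ^ 2 ∂gpConditional D a :=
        Finset.sum_congr rfl fun i _ => lintegral_finsetSum _ fun j _ => .of_discrete
    _ ≤ ∑ i, ∑ j, 2 * ((ENNReal.ofReal (D.mulVec a i) ^ 2 + ENNReal.ofReal (D.mulVec a i)) *
        (ENNReal.ofReal (D.mulVec a j) ^ 2 + ENNReal.ofReal (D.mulVec a j))) :=
        Finset.sum_le_sum fun i _ => Finset.sum_le_sum fun j _ =>
          lintegral_pairCount_sq_gpConditional_le D a i j
    _ = 2 * (∑ i, (ENNReal.ofReal (D.mulVec a i) ^ 2 + ENNReal.ofReal (D.mulVec a i))) ^ 2 := by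
        rw [pow_two, Finset.sum_mul_sum]
        simp_rw [Finset.mul_sum]
    _ ≤ _ := by
        rw [Finset.sum_add_distrib, sum_ofReal_mulVec hD ha]
        gcongr
        exact sum_ofReal_mulVec_sq_le hD ha

/-- Drops the cross term, so that only the second and fourth moments of the total intensity enter
the bound for `pairCount`. -/
theorem ENNReal.two_mul_add_sq_le (x y : ℝ≥0∞) : 2 * (x + y) ^ 2 ≤ 4 * (x ^ 2 + y ^ 2) := by
  rcases eq_or_ne x ⊤ with rfl | hx
  · simp [ENNReal.mul_top]
  rcases eq_or_ne y ⊤ with rfl | hy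
  · simp [ENNReal.mul_top]
  lift x to ℝ≥0 using hx
  lift y to ℝ≥0 using hy
  norm_cast
  rw [← NNReal.coe_le_coe]
  push_cast
  nlinarith [sq_nonneg ((x : ℝ) - y)]

theorem maxTopicNormSq_nonneg (D : Matrix (Fin M) (Fin K) ℝ) : 0 ≤ maxTopicNormSq D :=
  Real.iSup_nonneg fun _ => sq_nonneg _

theorem sum_lintegral_apply_gpLaw_eq (hD : ∀ k, D.col k ∈ stdSimplex ℝ (Fin M))
    (hc : ∀ k, 0 < c k) (hb : 0 < b) :
    ∑ i, ∫⁻ x, (x i : ℝ≥0∞) ∂gpLaw D c b = ENNReal.ofReal ((∑ k, c k) / b) := by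
  rw [sum_lintegral_apply_gpLaw hD hc hb, (hasGammaMoments_sum_pi hc hb).one,
    ← ENNReal.ofReal_mul (by positivity), inv_mul_eq_div]

theorem sum_lintegral_apply_sq_gpLaw_le_ofReal (hD : ∀ k, D.col k ∈ stdSimplex ℝ (Fin M))
    (hc : ∀ k, 0 < c k) (hb : 0 < b) :
    ∑ i, ∫⁻ x, (x i : ℝ≥0∞) ^ 2 ∂gpLaw D c b ≤
      ENNReal.ofReal (maxTopicNormSq D * (b⁻¹ ^ 2 * ((∑ k, c k) * (∑ k, c k + 1)))
        + b⁻¹ * ∑ k, c k) := by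
  have hΔ := maxTopicNormSq_nonneg D
  have hC : 0 ≤ ∑ k, c k := Finset.sum_nonneg fun k _ => (hc k).le
  have H := hasGammaMoments_sum_pi hc hb
  refine (sum_lintegral_apply_sq_gpLaw_le hD hc hb).trans (le_of_eq ?_)
  rw [lintegral_add_left (by fun_prop), lintegral_const_mul _ (by fun_prop), H.one, H.two,
    ENNReal.ofReal_add (by positivity) (by positivity), ENNReal.ofReal_mul hΔ,
    ENNReal.ofReal_mul (by positivity), ENNReal.ofReal_mul hC, ENNReal.ofReal_add hC zero_le_one,
    ENNReal.ofReal_mul (by positivity), ENNReal.ofReal_pow (by positivity), ENNReal.ofReal_one]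

theorem sum_lintegral_pairCount_sq_gpLaw_le_ofReal (hD : ∀ k, D.col k ∈ stdSimplex ℝ (Fin M))
    (hc : ∀ k, 0 < c k) (hb : 0 < b) :
    ∑ i, ∑ j, ∫⁻ x, (pairCount x i j : ℝ≥0∞) ^ 2 ∂gpLaw D c b ≤
      ENNReal.ofReal (4 * (maxTopicNormSq D ^ 2 *
        (b⁻¹ ^ 4 * ((∑ k, c k) * (∑ k, c k + 1) * (∑ k, c k + 2) * (∑ k, c k + 3)))
        + b⁻¹ ^ 2 * ((∑ k, c k) * (∑ k, c k + 1)))) := by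
  have hΔ := maxTopicNormSq_nonneg D
  have hC : 0 ≤ ∑ k, c k := Finset.sum_nonneg fun k _ => (hc k).le
  have H := hasGammaMoments_sum_pi hc hb
  refine (sum_lintegral_pairCount_sq_gpLaw_le hD hc hb).trans
    ((lintegral_mono fun a => ENNReal.two_mul_add_sq_le _ _).trans (le_of_eq ?_))
  simp_rw [mul_pow, ← pow_mul]
  rw [lintegral_const_mul _ (by fun_prop), lintegral_add_left (by fun_prop),
    lintegral_const_mul _ (by fun_prop), H.four, H.two,
    ENNReal.ofReal_mul (by positivity), ENNReal.ofReal_add (by positivity) (by positivity),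
    ENNReal.ofReal_mul (by positivity), ENNReal.ofReal_mul (by positivity),
    ENNReal.ofReal_mul (by positivity), ENNReal.ofReal_mul (by positivity),
    ENNReal.ofReal_mul (by positivity), ENNReal.ofReal_mul (by positivity),
    ENNReal.ofReal_mul (by positivity),
    ENNReal.ofReal_add hC zero_le_one, ENNReal.ofReal_add hC zero_le_two,
    ENNReal.ofReal_add hC zero_le_three, ENNReal.ofReal_pow hΔ,
    ENNReal.ofReal_pow (by positivity), ENNReal.ofReal_pow (by positivity), ENNReal.ofReal_one,
    ENNReal.ofReal_ofNat, ENNReal.ofReal_ofNat, ENNReal.ofReal_ofNat]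

end LawMoments

/-! ### Passage from extended nonnegative to real integrals -/

section NatCast

variable {Ω : Type*} [MeasurableSpace Ω] {μ : Measure Ω} {g : Ω → ℕ}

theorem enorm_natCast_real (n : ℕ) : ‖(n : ℝ)‖ₑ = n := by
  rw [Real.enorm_of_nonneg n.cast_nonneg, ENNReal.ofReal_natCast]

theorem memLp_two_natCast (hg : Measurable g) (h : ∫⁻ ω, (g ω : ℝ≥0∞) ^ 2 ∂μ ≠ ⊤) :
    MemLp (fun ω => (g ω : ℝ)) 2 μ := by
  have hm : Measurable fun ω => (g ω : ℝ) := (Measurable.of_discrete (f := Nat.cast)).comp hg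
  refine (memLp_two_iff_integrable_sq hm.aestronglyMeasurable).2
    ⟨(hm.pow_const 2).aestronglyMeasurable, ?_⟩
  simpa [HasFiniteIntegral, enorm_pow, enorm_natCast_real, lt_top_iff_ne_top] using h

theorem integral_natCast_pow (hg : Measurable g) (p : ℕ) :
    ∫ ω, (g ω : ℝ) ^ p ∂μ = (∫⁻ ω, (g ω : ℝ≥0∞) ^ p ∂μ).toReal := by
  have hm : Measurable fun ω => (g ω : ℝ) := (Measurable.of_discrete (f := Nat.cast)).comp hg
  rw [integral_eq_lintegral_of_nonneg_ae (ae_of_all _ fun ω => by positivity)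
    (hm.pow_const p).aestronglyMeasurable]
  simp [ENNReal.ofReal_pow]

end NatCast

section RealMoments

variable {M K : ℕ} {D : Matrix (Fin M) (Fin K) ℝ} {c : Fin K → ℝ} {b : ℝ}

theorem lintegral_apply_sq_gpLaw_ne_top (hD : ∀ k, D.col k ∈ stdSimplex ℝ (Fin M))
    (hc : ∀ k, 0 < c k) (hb : 0 < b) (i : Fin M) :
    ∫⁻ x, (x i : ℝ≥0∞) ^ 2 ∂gpLaw D c b ≠ ⊤ :=
  ENNReal.sum_ne_top.1
    (((sum_lintegral_apply_sq_gpLaw_le_ofReal hD hc hb).trans_lt ENNReal.ofReal_lt_top).ne) i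
    (Finset.mem_univ i)

theorem lintegral_pairCount_sq_gpLaw_ne_top (hD : ∀ k, D.col k ∈ stdSimplex ℝ (Fin M))
    (hc : ∀ k, 0 < c k) (hb : 0 < b) (i j : Fin M) :
    ∫⁻ x, (pairCount x i j : ℝ≥0∞) ^ 2 ∂gpLaw D c b ≠ ⊤ :=
  ENNReal.sum_ne_top.1 (ENNReal.sum_ne_top.1
    (((sum_lintegral_pairCount_sq_gpLaw_le_ofReal hD hc hb).trans_lt ENNReal.ofReal_lt_top).ne) i
    (Finset.mem_univ i)) j (Finset.mem_univ j)

theorem memLp_apply_gpLaw (hD : ∀ k, D.col k ∈ stdSimplex ℝ (Fin M))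
    (hc : ∀ k, 0 < c k) (hb : 0 < b) (i : Fin M) :
    MemLp (fun x : Fin M → ℕ => (x i : ℝ)) 2 (gpLaw D c b) :=
  memLp_two_natCast .of_discrete (lintegral_apply_sq_gpLaw_ne_top hD hc hb i)

theorem memLp_pairCount_gpLaw (hD : ∀ k, D.col k ∈ stdSimplex ℝ (Fin M))
    (hc : ∀ k, 0 < c k) (hb : 0 < b) (i j : Fin M) :
    MemLp (fun x : Fin M → ℕ => (pairCount x i j : ℝ)) 2 (gpLaw D c b) :=
  memLp_two_natCast .of_discrete (lintegral_pairCount_sq_gpLaw_ne_top hD hc hb i j)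

theorem gpMeanLength_eq (hD : ∀ k, D.col k ∈ stdSimplex ℝ (Fin M))
    (hc : ∀ k, 0 < c k) (hb : 0 < b) : gpMeanLength D c b = (∑ k, c k) / b := by
  have := isProbabilityMeasure_gpLaw D hc hb
  have hC : 0 ≤ ∑ k, c k := Finset.sum_nonneg fun k _ => (hc k).le
  have h := sum_lintegral_apply_gpLaw_eq hD hc hb
  have h1 := fun i : Fin M => integral_natCast_pow (μ := gpLaw D c b) (g := fun x => x i)
    .of_discrete 1
  simp only [pow_one] at h1
  rw [gpMeanLength, integral_finsetSum _ fun i _ =>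
    (memLp_apply_gpLaw hD hc hb i).integrable one_le_two]
  simp_rw [h1]
  have htop : ∀ i ∈ Finset.univ, ∫⁻ x, (x i : ℝ≥0∞) ∂gpLaw D c b ≠ ⊤ :=
    ENNReal.sum_ne_top.1 (h ▸ ENNReal.ofReal_ne_top)
  rw [← ENNReal.toReal_sum htop, h, ENNReal.toReal_ofReal (by positivity)]

theorem sum_integral_apply_sq_gpLaw_le (hD : ∀ k, D.col k ∈ stdSimplex ℝ (Fin M))
    (hc : ∀ k, 0 < c k) (hb : 0 < b) :
    ∑ i, ∫ x, (x i : ℝ) ^ 2 ∂gpLaw D c b ≤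
      maxTopicNormSq D * (b⁻¹ ^ 2 * ((∑ k, c k) * (∑ k, c k + 1))) + b⁻¹ * ∑ k, c k := by
  have hΔ := maxTopicNormSq_nonneg D
  have hC : 0 ≤ ∑ k, c k := Finset.sum_nonneg fun k _ => (hc k).le
  simp_rw [fun i : Fin M => integral_natCast_pow (μ := gpLaw D c b) (g := fun x => x i)
    .of_discrete 2]
  rw [← ENNReal.toReal_sum fun i _ => lintegral_apply_sq_gpLaw_ne_top hD hc hb i]
  exact ENNReal.toReal_le_of_le_ofReal (by positivity)
    (sum_lintegral_apply_sq_gpLaw_le_ofReal hD hc hb)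

theorem sum_integral_pairCount_sq_gpLaw_le (hD : ∀ k, D.col k ∈ stdSimplex ℝ (Fin M))
    (hc : ∀ k, 0 < c k) (hb : 0 < b) :
    ∑ i, ∑ j, ∫ x, (pairCount x i j : ℝ) ^ 2 ∂gpLaw D c b ≤
      4 * (maxTopicNormSq D ^ 2 *
        (b⁻¹ ^ 4 * ((∑ k, c k) * (∑ k, c k + 1) * (∑ k, c k + 2) * (∑ k, c k + 3)))
        + b⁻¹ ^ 2 * ((∑ k, c k) * (∑ k, c k + 1))) := by
  have hΔ := maxTopicNormSq_nonneg D
  have hC : 0 ≤ ∑ k, c k := Finset.sum_nonneg fun k _ => (hc k).le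
  have h := fun i j => lintegral_pairCount_sq_gpLaw_ne_top hD hc hb i j
  simp_rw [fun i j : Fin M => integral_natCast_pow (μ := gpLaw D c b)
    (g := fun x => pairCount x i j) .of_discrete 2, ← ENNReal.toReal_sum fun j _ => h _ j]
  rw [← ENNReal.toReal_sum fun i _ => ENNReal.sum_ne_top.2 fun j _ => h i j]
  exact ENNReal.toReal_le_of_le_ofReal (by positivity)
    (sum_lintegral_pairCount_sq_gpLaw_le_ofReal hD hc hb)

end RealMoments

/-! ### Variance of a sum over pairs -/

section UStatistic

variable {Ω : Type*} [MeasurableSpace Ω] {P : Measure Ω} [IsProbabilityMeasure P]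

/-- Expand `0 ≤ Var (X - Y)`. -/
theorem covariance_le_of_variance_le {X Y : Ω → ℝ} (hX : MemLp X 2 P) (hY : MemLp Y 2 P) {V : ℝ}
    (hXV : Var[X; P] ≤ V) (hYV : Var[Y; P] ≤ V) : cov[X, Y; P] ≤ V := by
  have h := variance_nonneg (X - Y) P
  rw [variance_sub hX hY] at h
  linarith

theorem card_offDiag_univ (N : ℕ) :
    ((Finset.univ : Finset (Fin N)).offDiag.card : ℝ) = N * (N - 1) := by
  rw [Finset.offDiag_card, Finset.card_univ, Fintype.card_fin, Nat.cast_sub (Nat.le_mul_self N)]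
  push_cast
  ring

/-- Variance bound for a sum over ordered pairs whose terms are independent when the pairs are
disjoint. -/
theorem variance_sum_offDiag_le {N : ℕ} {Y : Fin N × Fin N → Ω → ℝ} {V : ℝ}
    (hY : ∀ p ∈ (Finset.univ : Finset (Fin N)).offDiag, MemLp (Y p) 2 P)
    (hV : ∀ p ∈ (Finset.univ : Finset (Fin N)).offDiag, Var[Y p; P] ≤ V)
    (hind : ∀ p q : Fin N × Fin N, p.1 ≠ q.1 → p.1 ≠ q.2 → p.2 ≠ q.1 → p.2 ≠ q.2 →
      IndepFun (Y p) (Y q) P) :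
    Var[fun ω => ∑ p ∈ (Finset.univ : Finset (Fin N)).offDiag, Y p ω; P] ≤
      N * (N - 1) * (4 * N * V) := by
  classical
  set s := (Finset.univ : Finset (Fin N)).offDiag with hs
  have hcard : (s.card : ℝ) = N * (N - 1) := card_offDiag_univ N
  -- The sign of `V` is read off from an actual pair, hence the separate empty case.
  rcases s.eq_empty_or_nonempty with he | ⟨p₀, hp₀⟩
  · rw [← hcard, he]
    simp only [Finset.sum_empty, Finset.card_empty, Nat.cast_zero, zero_mul]
    exact (variance_zero P).le
  have hV0 : 0 ≤ V := (variance_nonneg _ _).trans (hV p₀ hp₀)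
  rw [variance_fun_sum' hY]
  -- `V` times the Kronecker delta. Four of these cover the four ways in which `p` and `q` can share
  -- an index; each fixes one coordinate of `q` and leaves the other free, so a row of covariances
  -- sums to at most `4 N V`.
  let e : Fin N → Fin N → ℝ := fun i j => if i = j then V else 0
  have he : ∀ i j, 0 ≤ e i j := fun i j => by simp only [e]; split_ifs <;> simp [hV0]
  have hcov : ∀ p ∈ s, ∀ q ∈ s, cov[Y p, Y q; P] ≤
      (e p.1 q.1 + e p.2 q.1) + (e p.1 q.2 + e p.2 q.2) := by
    intro p hp q hq
    by_cases hdis : p.1 ≠ q.1 ∧ p.1 ≠ q.2 ∧ p.2 ≠ q.1 ∧ p.2 ≠ q.2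
    · rw [(hind p q hdis.1 hdis.2.1 hdis.2.2.1 hdis.2.2.2).covariance_eq_zero (hY p hp) (hY q hq)]
      have := he p.1 q.1; have := he p.2 q.1; have := he p.1 q.2; have := he p.2 q.2
      positivity
    · refine (covariance_le_of_variance_le (hY p hp) (hY q hq) (hV p hp) (hV q hq)).trans ?_
      have h1 := he p.1 q.1; have h2 := he p.2 q.1; have h3 := he p.1 q.2; have h4 := he p.2 q.2
      have : V = e p.1 q.1 ∨ V = e p.1 q.2 ∨ V = e p.2 q.1 ∨ V = e p.2 q.2 := by
        by_contra hcon
        push Not at hcon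
        refine hdis ⟨?_, ?_, ?_, ?_⟩ <;> intro heq <;> simp [e, heq] at hcon
      rcases this with h | h | h | h <;> linarith
  have hrow : ∀ p ∈ s, ∑ q ∈ s, cov[Y p, Y q; P] ≤ 4 * N * V := by
    intro p hp
    calc ∑ q ∈ s, cov[Y p, Y q; P]
        ≤ ∑ q ∈ s, ((e p.1 q.1 + e p.2 q.1) + (e p.1 q.2 + e p.2 q.2)) :=
          Finset.sum_le_sum fun q hq => hcov p hp q hq
      _ ≤ ∑ q : Fin N × Fin N, ((e p.1 q.1 + e p.2 q.1) + (e p.1 q.2 + e p.2 q.2)) :=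
          Finset.sum_le_univ_sum_of_nonneg fun q =>
            add_nonneg (add_nonneg (he _ _) (he _ _)) (add_nonneg (he _ _) (he _ _))
      _ = 4 * N * V := by
          rw [Fintype.sum_prod_type]
          simp only [Finset.sum_add_distrib, Finset.sum_const, Finset.card_univ, Fintype.card_fin,
            nsmul_eq_mul, e, Finset.sum_ite_eq, Finset.mem_univ, if_true, ← Finset.mul_sum]
          ring
  calc ∑ p ∈ s, ∑ q ∈ s, cov[Y p, Y q; P] ≤ ∑ p ∈ s, 4 * N * V := Finset.sum_le_sum hrow
    _ = N * (N - 1) * (4 * N * V) := by rw [Finset.sum_const, nsmul_eq_mul, hcard]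

end UStatistic

/-! ### The estimator as a U-statistic -/

/-- The symmetric kernel whose U-statistic is `gpEstimator`. -/
noncomputable def pairKernel {M : ℕ} (i j : Fin M) (x y : Fin M → ℕ) : ℝ :=
  ((pairCount x i j : ℝ) + pairCount y i j) / 2 - ((x i : ℝ) * y j + y i * x j) / 2

theorem sum_offDiag_eq_sub {N : ℕ} (F : Fin N → Fin N → ℝ) :
    ∑ p ∈ (Finset.univ : Finset (Fin N)).offDiag, F p.1 p.2 =
      (∑ n, ∑ m, F n m) - ∑ n, F n n := by
  have h := Finset.sum_union (f := fun p : Fin N × Fin N => F p.1 p.2)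
    (Finset.disjoint_diag_offDiag (Finset.univ : Finset (Fin N)))
  rw [Finset.diag_union_offDiag, Finset.univ_product_univ, Fintype.sum_prod_type,
    Finset.sum_diag] at h
  linarith

/-- The sample covariance is the U-statistic of `(u - u')(v - v') / 2`, and the sample mean that of
`(u + u') / 2`; on the diagonal `pairKernel` is their difference. -/
theorem gpEstimator_apply_eq {N M : ℕ} (hN : 2 ≤ N) (X : Fin N → Fin M → ℕ) (i j : Fin M) :
    gpEstimator X i j = ((N : ℝ) * (N - 1))⁻¹ *
      ∑ p ∈ (Finset.univ : Finset (Fin N)).offDiag, pairKernel i j (X p.1) (X p.2) := by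
  have hN2 : (2 : ℝ) ≤ N := by exact_mod_cast hN
  have hN0 : (N : ℝ) ≠ 0 := by positivity
  have hN1 : (N : ℝ) - 1 ≠ 0 := by linarith
  rw [sum_offDiag_eq_sub fun n m => pairKernel i j (X n) (X m)]
  simp only [gpEstimator, sampleCov, sampleMean, Matrix.sub_apply, Matrix.of_apply,
    Matrix.diagonal_apply, pairKernel, natCast_pairCount]
  set u : Fin N → ℝ := fun n => X n i with hu
  set v : Fin N → ℝ := fun n => X n j with hv
  -- `w` is the diagonal correction: `u` when `i = j`, and `0` otherwise.
  have key : ∀ w : Fin N → ℝ, ((1 / ((N : ℝ) - 1)) *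
        ∑ n, (u n - 1 / N * ∑ n, u n) * (v n - 1 / N * ∑ n, v n)) - 1 / N * ∑ n, w n
      = ((N : ℝ) * (N - 1))⁻¹ * ((∑ n, ∑ m, (((u n * v n - w n) + (u m * v m - w m)) / 2
          - (u n * v m + u m * v n) / 2))
        - ∑ n, (((u n * v n - w n) + (u n * v n - w n)) / 2 - (u n * v n + u n * v n) / 2)) := by
    intro w
    have e1 : ∑ n, (u n - 1 / N * ∑ n, u n) * (v n - 1 / N * ∑ n, v n)
        = ∑ n, u n * v n - 1 / N * ((∑ n, u n) * ∑ n, v n) := by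
      simp only [sub_mul, mul_sub, Finset.sum_sub_distrib, ← Finset.sum_mul, ← Finset.mul_sum,
        Finset.sum_const, Finset.card_univ, Fintype.card_fin, nsmul_eq_mul]
      field_simp
      ring
    have e2 : ∑ n, ∑ m, (((u n * v n - w n) + (u m * v m - w m)) / 2
          - (u n * v m + u m * v n) / 2)
        = N * (∑ n, u n * v n - ∑ n, w n) - (∑ n, u n) * ∑ n, v n := by
      have e3 : ∑ n, ∑ m, u n * v m = (∑ n, u n) * ∑ n, v n := (Finset.sum_mul_sum _ _ _ _).symm
      have e4 : ∑ n, ∑ m, u m * v n = (∑ n, u n) * ∑ n, v n := by rw [Finset.sum_comm, e3]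
      simp only [Finset.sum_sub_distrib, ← Finset.sum_div, Finset.sum_add_distrib, e3, e4,
        Finset.sum_const, Finset.card_univ, Fintype.card_fin, nsmul_eq_mul]
      simp only [← Finset.mul_sum]
      ring
    have e5 : ∑ n, (((u n * v n - w n) + (u n * v n - w n)) / 2 - (u n * v n + u n * v n) / 2)
        = - ∑ n, w n := by
      rw [← Finset.sum_neg_distrib]
      exact Finset.sum_congr rfl fun n _ => by ring
    rw [e1, e2, e5]
    field_simp
    ring
  by_cases h : i = j
  · simpa [h, hu, hv] using key u
  · simpa [h, hu, hv] using key 0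

/-! ### Mean and variance of the kernel -/

section Estimator

variable {Ω : Type*} [MeasurableSpace Ω] {P : Measure Ω} {M : ℕ}
  {μ : Measure (Fin M → ℕ)}

theorem ProbabilityTheory.HasLaw.memLp_comp {𝓧 : Type*} [MeasurableSpace 𝓧] {X : Ω → 𝓧}
    {ν : Measure 𝓧} (hX : HasLaw X ν P) {f : 𝓧 → ℝ} {p : ℝ≥0∞} (hf : MemLp f p ν) :
    MemLp (fun ω => f (X ω)) p P :=
  MemLp.comp_of_map (by rwa [hX.map_eq]) hX.aemeasurable

/-- The squares are independent and integrable, so their product is integrable; without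
independence, fourth moments would be the natural requirement. -/
theorem ProbabilityTheory.IndepFun.memLp_two_mul {X Y : Ω → ℝ} (h : IndepFun X Y P)
    (hX : MemLp X 2 P) (hY : MemLp Y 2 P) : MemLp (fun ω => X ω * Y ω) 2 P := by
  refine (memLp_two_iff_integrable_sq (hX.1.mul hY.1)).2 ?_
  have := (h.comp (measurable_id.pow_const 2) (measurable_id.pow_const 2)).integrable_mul
    hX.integrable_sq hY.integrable_sq
  refine this.congr (ae_of_all _ fun ω => ?_)
  simp [mul_pow]

theorem ProbabilityTheory.IndepFun.integral_mul_sq {X Y : Ω → ℝ} (h : IndepFun X Y P)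
    (hX : MemLp X 2 P) (hY : MemLp Y 2 P) :
    ∫ ω, (X ω * Y ω) ^ 2 ∂P = (∫ ω, X ω ^ 2 ∂P) * ∫ ω, Y ω ^ 2 ∂P := by
  simp_rw [mul_pow]
  exact (h.comp (measurable_id.pow_const 2) (measurable_id.pow_const 2)).integral_fun_mul_eq_mul_integral
    hX.integrable_sq.1 hY.integrable_sq.1

variable {X Y : Ω → Fin M → ℕ}

theorem ProbabilityTheory.IndepFun.comp_of_discrete {f g : (Fin M → ℕ) → ℝ}
    (h : IndepFun X Y P) : IndepFun (fun ω => f (X ω)) (fun ω => g (Y ω)) P :=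
  h.comp (φ := f) (ψ := g) .of_discrete .of_discrete

theorem memLp_pairKernel (hX : HasLaw X μ P) (hY : HasLaw Y μ P)
    (h : IndepFun X Y P) {i j : Fin M} (hi : MemLp (fun x : Fin M → ℕ => (x i : ℝ)) 2 μ)
    (hj : MemLp (fun x : Fin M → ℕ => (x j : ℝ)) 2 μ)
    (hij : MemLp (fun x : Fin M → ℕ => (pairCount x i j : ℝ)) 2 μ) :
    MemLp (fun ω => pairKernel i j (X ω) (Y ω)) 2 P := by
  have a1 := (hX.memLp_comp hij).add (hY.memLp_comp hij)
  have a2 := (h.comp_of_discrete (f := fun x => x i) (g := fun x => x j)).memLp_two_mul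
    (hX.memLp_comp hi) (hY.memLp_comp hj)
  have a3 := (h.symm.comp_of_discrete (f := fun x => x i) (g := fun x => x j)).memLp_two_mul
    (hY.memLp_comp hi) (hX.memLp_comp hj)
  refine ((a1.const_mul 2⁻¹).sub ((a2.add a3).const_mul 2⁻¹)).ae_eq (ae_of_all _ fun ω => ?_)
  simp only [pairKernel, Pi.sub_apply, Pi.add_apply]
  ring

theorem integral_pairKernel [IsProbabilityMeasure P] (hX : HasLaw X μ P) (hY : HasLaw Y μ P)
    (h : IndepFun X Y P) {i j : Fin M} (hi : MemLp (fun x : Fin M → ℕ => (x i : ℝ)) 2 μ)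
    (hj : MemLp (fun x : Fin M → ℕ => (x j : ℝ)) 2 μ)
    (hij : MemLp (fun x : Fin M → ℕ => (pairCount x i j : ℝ)) 2 μ) :
    ∫ ω, pairKernel i j (X ω) (Y ω) ∂P =
    ∫ x, (pairCount x i j : ℝ) ∂μ - (∫ x, (x i : ℝ) ∂μ) * ∫ x, (x j : ℝ) ∂μ := by
  have a2 := (h.comp_of_discrete (f := fun x => x i) (g := fun x => x j))
  have a3 := (h.symm.comp_of_discrete (f := fun x => x i) (g := fun x => x j))
  have b2 := (a2.memLp_two_mul (hX.memLp_comp hi) (hY.memLp_comp hj)).integrable one_le_two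
  have b3 := (a3.memLp_two_mul (hY.memLp_comp hi) (hX.memLp_comp hj)).integrable one_le_two
  have fX := (hX.memLp_comp hij).integrable one_le_two
  have fY := (hY.memLp_comp hij).integrable one_le_two
  have L : ∀ {Z : Ω → Fin M → ℕ} (_ : HasLaw Z μ P) (f : (Fin M → ℕ) → ℝ),
      ∫ ω, f (Z ω) ∂P = ∫ x, f x ∂μ := fun hZ f => hZ.integral_comp (f := f) .of_discrete
  simp only [pairKernel]
  rw [integral_sub ((fX.fun_add fY).div_const 2) ((b2.fun_add b3).div_const 2), integral_div, integral_div,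
    integral_add fX fY, integral_add b2 b3,
    a2.integral_fun_mul_eq_mul_integral (hX.memLp_comp hi).1 (hY.memLp_comp hj).1,
    a3.integral_fun_mul_eq_mul_integral (hY.memLp_comp hi).1 (hX.memLp_comp hj).1,
    L hX fun x => (pairCount x i j : ℝ), L hY fun x => (pairCount x i j : ℝ),
    L hX fun x => (x i : ℝ), L hY fun x => (x i : ℝ),
    L hX fun x => (x j : ℝ), L hY fun x => (x j : ℝ)]
  ring

theorem variance_pairKernel_le [IsProbabilityMeasure P] (hX : HasLaw X μ P) (hY : HasLaw Y μ P)
    (h : IndepFun X Y P) {i j : Fin M} (hi : MemLp (fun x : Fin M → ℕ => (x i : ℝ)) 2 μ)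
    (hj : MemLp (fun x : Fin M → ℕ => (x j : ℝ)) 2 μ)
    (hij : MemLp (fun x : Fin M → ℕ => (pairCount x i j : ℝ)) 2 μ) :
    Var[fun ω => pairKernel i j (X ω) (Y ω); P] ≤
    2 * ∫ x, (pairCount x i j : ℝ) ^ 2 ∂μ
      + 2 * ((∫ x, (x i : ℝ) ^ 2 ∂μ) * ∫ x, (x j : ℝ) ^ 2 ∂μ) := by
  have hm := memLp_pairKernel hX hY h hi hj hij
  refine (variance_le_expectation_sq hm.1).trans ?_
  have a2 := (h.comp_of_discrete (f := fun x => x i) (g := fun x => x j))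
  have a3 := (h.symm.comp_of_discrete (f := fun x => x i) (g := fun x => x j))
  have b2 := (a2.memLp_two_mul (hX.memLp_comp hi) (hY.memLp_comp hj)).integrable_sq
  have b3 := (a3.memLp_two_mul (hY.memLp_comp hi) (hX.memLp_comp hj)).integrable_sq
  have fX := (hX.memLp_comp hij).integrable_sq
  have fY := (hY.memLp_comp hij).integrable_sq
  have L : ∀ {Z : Ω → Fin M → ℕ} (_ : HasLaw Z μ P) (f : (Fin M → ℕ) → ℝ),
      ∫ ω, f (Z ω) ∂P = ∫ x, f x ∂μ := fun hZ f => hZ.integral_comp (f := f) .of_discrete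
  calc ∫ ω, pairKernel i j (X ω) (Y ω) ^ 2 ∂P
      ≤ ∫ ω, (((pairCount (X ω) i j : ℝ) ^ 2 + (pairCount (Y ω) i j : ℝ) ^ 2)
        + (((X ω i : ℝ) * Y ω j) ^ 2 + ((Y ω i : ℝ) * X ω j) ^ 2)) ∂P := by
        -- Pointwise this is `((s + t - u - v) / 2)² ≤ s² + t² + u² + v²`, Cauchy–Schwarz with four
        -- terms.
        refine integral_mono hm.integrable_sq ((fX.fun_add fY).add (b2.fun_add b3)) fun ω => ?_
        simp only [pairKernel]
        generalize (pairCount (X ω) i j : ℝ) = s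
        generalize (pairCount (Y ω) i j : ℝ) = t
        generalize (X ω i : ℝ) * Y ω j = u
        generalize (Y ω i : ℝ) * X ω j = v
        nlinarith [sq_nonneg (s - t), sq_nonneg (u - v), sq_nonneg (s + t + (u + v))]
    _ = _ := by
        rw [integral_add (fX.fun_add fY) (b2.fun_add b3), integral_add fX fY, integral_add b2 b3,
          a2.integral_mul_sq (hX.memLp_comp hi) (hY.memLp_comp hj),
          a3.integral_mul_sq (hY.memLp_comp hi) (hX.memLp_comp hj),
          L hX fun x => (pairCount x i j : ℝ) ^ 2, L hY fun x => (pairCount x i j : ℝ) ^ 2,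
          L hX fun x => (x i : ℝ) ^ 2, L hY fun x => (x i : ℝ) ^ 2,
          L hX fun x => (x j : ℝ) ^ 2, L hY fun x => (x j : ℝ) ^ 2]
        ring

end Estimator

/-! ### Mean and variance of the entries of the estimator -/

section Sample

variable {Ω : Type*} [MeasurableSpace Ω] {P : Measure Ω} {M N : ℕ} {μ : Measure (Fin M → ℕ)}
  {x : Fin N → Ω → Fin M → ℕ} {i j : Fin M}

theorem memLp_gpEstimator (hN : 2 ≤ N) (hx : ∀ n, HasLaw (x n) μ P) (hind : iIndepFun x P)
    (hi : MemLp (fun x : Fin M → ℕ => (x i : ℝ)) 2 μ)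
    (hj : MemLp (fun x : Fin M → ℕ => (x j : ℝ)) 2 μ)
    (hij : MemLp (fun x : Fin M → ℕ => (pairCount x i j : ℝ)) 2 μ) :
    MemLp (fun ω => gpEstimator (fun n => x n ω) i j) 2 P := by
  simp_rw [gpEstimator_apply_eq hN]
  have h := memLp_finsetSum (Finset.univ : Finset (Fin N)).offDiag (μ := P) (p := 2)
    (f := fun p ω => pairKernel i j (x p.1 ω) (x p.2 ω)) fun p hp =>
      memLp_pairKernel (hx p.1) (hx p.2) (hind.indepFun (Finset.mem_offDiag.1 hp).2.2) hi hj hij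
  exact h.const_mul _

theorem integral_gpEstimator [IsProbabilityMeasure P] (hN : 2 ≤ N) (hx : ∀ n, HasLaw (x n) μ P)
    (hind : iIndepFun x P) (hi : MemLp (fun x : Fin M → ℕ => (x i : ℝ)) 2 μ)
    (hj : MemLp (fun x : Fin M → ℕ => (x j : ℝ)) 2 μ)
    (hij : MemLp (fun x : Fin M → ℕ => (pairCount x i j : ℝ)) 2 μ) :
    ∫ ω, gpEstimator (fun n => x n ω) i j ∂P =
      ∫ x, (pairCount x i j : ℝ) ∂μ - (∫ x, (x i : ℝ) ∂μ) * ∫ x, (x j : ℝ) ∂μ := by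
  have hN2 : (2 : ℝ) ≤ N := by exact_mod_cast hN
  have hN1 : (N : ℝ) - 1 ≠ 0 := by linarith
  have hp : ∀ p ∈ (Finset.univ : Finset (Fin N)).offDiag, IndepFun (x p.1) (x p.2) P :=
    fun p hp => hind.indepFun (Finset.mem_offDiag.1 hp).2.2
  simp_rw [gpEstimator_apply_eq hN]
  rw [integral_const_mul, integral_finsetSum _ fun p h =>
      (memLp_pairKernel (hx p.1) (hx p.2) (hp p h) hi hj hij).integrable ?_,
    Finset.sum_congr rfl fun p h =>
      integral_pairKernel (hx p.1) (hx p.2) (hp p h) hi hj hij, Finset.sum_const, nsmul_eq_mul,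
    card_offDiag_univ, ← mul_assoc, inv_mul_cancel₀ (by positivity), one_mul]
  exact one_le_two

theorem variance_gpEstimator_le [IsProbabilityMeasure P] (hN : 2 ≤ N)
    (hx : ∀ n, HasLaw (x n) μ P)
    (hind : iIndepFun x P) (hi : MemLp (fun x : Fin M → ℕ => (x i : ℝ)) 2 μ)
    (hj : MemLp (fun x : Fin M → ℕ => (x j : ℝ)) 2 μ)
    (hij : MemLp (fun x : Fin M → ℕ => (pairCount x i j : ℝ)) 2 μ) :
    Var[fun ω => gpEstimator (fun n => x n ω) i j; P] ≤
      16 / N * (∫ x, (pairCount x i j : ℝ) ^ 2 ∂μ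
        + (∫ x, (x i : ℝ) ^ 2 ∂μ) * ∫ x, (x j : ℝ) ^ 2 ∂μ) := by
  have hN2 : (2 : ℝ) ≤ N := by exact_mod_cast hN
  have hN1 : 0 < (N : ℝ) - 1 := by linarith
  have hp : ∀ p ∈ (Finset.univ : Finset (Fin N)).offDiag, IndepFun (x p.1) (x p.2) P :=
    fun p hp => hind.indepFun (Finset.mem_offDiag.1 hp).2.2
  simp_rw [gpEstimator_apply_eq hN]
  rw [variance_const_mul]
  set V := ∫ x, (pairCount x i j : ℝ) ^ 2 ∂μ
        + (∫ x, (x i : ℝ) ^ 2 ∂μ) * ∫ x, (x j : ℝ) ^ 2 ∂μ with hV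
  have hV0 : 0 ≤ V := add_nonneg (integral_nonneg fun _ => sq_nonneg _)
    (mul_nonneg (integral_nonneg fun _ => sq_nonneg _) (integral_nonneg fun _ => sq_nonneg _))
  have hm : Measurable fun z : (Fin M → ℕ) × (Fin M → ℕ) => pairKernel i j z.1 z.2 := .of_discrete
  have hdis : ∀ p q : Fin N × Fin N, p.1 ≠ q.1 → p.1 ≠ q.2 → p.2 ≠ q.1 → p.2 ≠ q.2 →
      IndepFun (fun ω => pairKernel i j (x p.1 ω) (x p.2 ω))
        (fun ω => pairKernel i j (x q.1 ω) (x q.2 ω)) P := fun p q h1 h2 h3 h4 =>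
    (hind.indepFun_prodMk_prodMk₀ (fun n => (hx n).aemeasurable)
      p.1 p.2 q.1 q.2 h1 h2 h3 h4).comp hm hm
  have key := variance_sum_offDiag_le (P := P) (V := 2 * V)
    (Y := fun p ω => pairKernel i j (x p.1 ω) (x p.2 ω))
    (fun p h => memLp_pairKernel (hx p.1) (hx p.2) (hp p h) hi hj hij)
    (fun p h => (variance_pairKernel_le (hx p.1) (hx p.2) (hp p h) hi hj hij).trans
      (le_of_eq (by rw [hV]; ring))) hdis
  refine (mul_le_mul_of_nonneg_left key (sq_nonneg _)).trans ?_
  calc ((N : ℝ) * (N - 1))⁻¹ ^ 2 * (N * (N - 1) * (4 * N * (2 * V)))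
      = 8 / (N - 1) * V := by field_simp; ring
    _ ≤ 16 / N * V := by
        -- `8 / (N - 1) ≤ 16 / N` is exactly `N ≥ 2`.
        refine mul_le_mul_of_nonneg_right ?_ hV0
        rw [div_le_div_iff₀ hN1 (by positivity)]
        linarith

end Sample

/-! ### Frobenius norm and comparison with the mean length -/

theorem Matrix.frobenius_norm_sq_eq_sum {m n : Type*} [Fintype m] [Fintype n] (A : Matrix m n ℝ) :
    ‖A‖ ^ 2 = ∑ i, ∑ j, A i j ^ 2 := by
  rw [Matrix.frobenius_norm_def, ← Real.sqrt_eq_rpow, Real.sq_sqrt (by positivity)]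
  simp

/-- Comparison of the gamma moments of total shape `c` and rate `b` with powers of the mean
`L = c / b`. -/
theorem gamma_moment_bound {c b Δ s L m : ℝ} (hc : 0 < c) (hb : 0 < b) (hΔ : 0 ≤ Δ)
    (hs : s = min 1 c) (hL : L = c / b) (hm : m = max (Δ * L ^ 2) (s * L)) :
    4 * (Δ ^ 2 * (b⁻¹ ^ 4 * (c * (c + 1) * (c + 2) * (c + 3))) + b⁻¹ ^ 2 * (c * (c + 1)))
      + (Δ * (b⁻¹ ^ 2 * (c * (c + 1))) + b⁻¹ * c) ^ 2 ≤ 113 * m ^ 2 / s ^ 3 := by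
  have hs0 : 0 < s := by rw [hs]; exact lt_min one_pos hc
  have hs1 : s ≤ 1 := hs ▸ min_le_left _ _
  have hsc : s ≤ c := hs ▸ min_le_right _ _
  have hL0 : 0 < L := hL ▸ div_pos hc hb
  have hm1 : Δ * L ^ 2 ≤ m := hm ▸ le_max_left _ _
  have hm2 : s * L ≤ m := hm ▸ le_max_right _ _
  have hm0 : 0 ≤ m := le_trans (by positivity) hm2
  -- With `t = 1/s` and `d = 1/c ≤ t`, each gamma moment is a power of `L` times factors `1 + k d ≤
  -- (k + 1) t`. The fourth moment has three such factors, whence `t ^ 3`.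
  set t := s⁻¹ with ht
  have ht1 : 1 ≤ t := (one_le_inv₀ hs0).2 hs1
  set d := c⁻¹ with hd
  have hd0 : 0 < d := inv_pos.2 hc
  have hdt : d ≤ t := inv_anti₀ hs0 hsc
  -- The second branch of the maximum controls the bare powers of `L`, at the price of one `t` for
  -- each.
  have hLt : L ≤ m * t := by rw [ht, ← div_eq_mul_inv, le_div_iff₀ hs0]; linarith
  have e1 : b⁻¹ * c = L := by rw [hL]; ring
  have e2 : b⁻¹ ^ 2 * (c * (c + 1)) = L ^ 2 * (1 + d) := by rw [hL, hd]; field_simp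
  have e4 : b⁻¹ ^ 4 * (c * (c + 1) * (c + 2) * (c + 3)) =
      L ^ 4 * ((1 + d) * (1 + 2 * d) * (1 + 3 * d)) := by rw [hL, hd]; field_simp
  have b2 : 1 + d ≤ 2 * t := by linarith
  have b4 : (1 + d) * (1 + 2 * d) * (1 + 3 * d) ≤ 24 * t ^ 3 := by
    calc (1 + d) * (1 + 2 * d) * (1 + 3 * d) ≤ (2 * t) * (3 * t) * (4 * t) := by
          gcongr <;> linarith
      _ = 24 * t ^ 3 := by ring
  rw [e1, e2, e4]
  have t1 : Δ ^ 2 * (L ^ 4 * ((1 + d) * (1 + 2 * d) * (1 + 3 * d))) ≤ 24 * (m ^ 2 * t ^ 3) := by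
    calc Δ ^ 2 * (L ^ 4 * ((1 + d) * (1 + 2 * d) * (1 + 3 * d)))
        = (Δ * L ^ 2) ^ 2 * ((1 + d) * (1 + 2 * d) * (1 + 3 * d)) := by ring
      _ ≤ m ^ 2 * (24 * t ^ 3) := by gcongr
      _ = _ := by ring
  have t2 : L ^ 2 * (1 + d) ≤ 2 * (m ^ 2 * t ^ 3) := by
    calc L ^ 2 * (1 + d) ≤ (m * t) ^ 2 * (2 * t) := by gcongr
      _ = _ := by ring
  have t3 : (Δ * (L ^ 2 * (1 + d)) + L) ^ 2 ≤ 9 * (m ^ 2 * t ^ 3) := by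
    calc (Δ * (L ^ 2 * (1 + d)) + L) ^ 2 = (Δ * L ^ 2 * (1 + d) + L) ^ 2 := by ring
      _ ≤ (m * (2 * t) + m * t) ^ 2 := by gcongr
      _ = 9 * (m ^ 2 * t ^ 2) := by ring
      _ ≤ 9 * (m ^ 2 * t ^ 3) := by gcongr; norm_num
  have e5 : 113 * m ^ 2 / s ^ 3 = 113 * (m ^ 2 * t ^ 3) := by rw [ht]; field_simp
  rw [e5]
  -- The constant is `4 * (24 + 2) + 9 = 113`.
  linarith

/-! ### Unbiasedness and the error bound -/

section Main

variable {K M N : ℕ} {D : Matrix (Fin M) (Fin K) ℝ} {c : Fin K → ℝ} {b : ℝ}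

/-- Removing `E x_i` from the diagonal turns `E x_i²` into the factorial moment `E x_i (x_i - 1)`,
so the entry equals the mean found in `integral_pairKernel`. -/
theorem gpCumulant_apply_eq (hD : ∀ k, D.col k ∈ stdSimplex ℝ (Fin M)) (hc : ∀ k, 0 < c k)
    (hb : 0 < b) (i j : Fin M) :
    gpCumulant D c b i j = ∫ x, (pairCount x i j : ℝ) ∂gpLaw D c b
      - (∫ x, (x i : ℝ) ∂gpLaw D c b) * ∫ x, (x j : ℝ) ∂gpLaw D c b := by
  have := isProbabilityMeasure_gpLaw D hc hb
  have hi := memLp_apply_gpLaw hD hc hb i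
  have hj := memLp_apply_gpLaw hD hc hb j
  simp only [gpCumulant, Matrix.sub_apply, Matrix.of_apply, Matrix.diagonal_apply,
    natCast_pairCount]
  rw [covariance_eq_sub hi hj]
  have hmul : Integrable (fun x : Fin M → ℕ => (x i : ℝ) * x j) (gpLaw D c b) :=
    hi.integrable_mul hj
  by_cases h : i = j
  · simp only [h, if_true]
    subst h
    rw [integral_sub hmul (hi.integrable one_le_two)]
    simp only [Pi.mul_apply]
    ring
  · simp [h]

/-- By unbiasedness the integral is the sum of the variances of the entries; the products of second
moments then add up to a perfect square. -/
theorem integral_norm_sub_sq_le {Ω : Type*} [MeasurableSpace Ω] {P : Measure Ω}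
    [IsProbabilityMeasure P] (hK : 1 ≤ K) (hN : 2 ≤ N)
    (hD : ∀ k, D.col k ∈ stdSimplex ℝ (Fin M)) (hc : ∀ k, 0 < c k) (hb : 0 < b)
    {x : Fin N → Ω → Fin M → ℕ} (hx : ∀ n, HasLaw (x n) (gpLaw D c b) P) (hind : iIndepFun x P) :
    Integrable (fun ω => ‖gpEstimator (fun n => x n ω) - gpCumulant D c b‖ ^ 2) P ∧
    ∫ ω, ‖gpEstimator (fun n => x n ω) - gpCumulant D c b‖ ^ 2 ∂P ≤
      16 / N * (113 * max (maxTopicNormSq D * gpMeanLength D c b ^ 2)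
        (cappedShape c * gpMeanLength D c b) ^ 2 / cappedShape c ^ 3) := by
  have hi := memLp_apply_gpLaw hD hc hb
  have hij := memLp_pairCount_gpLaw hD hc hb
  have hmem := fun i j => memLp_gpEstimator hN hx hind (hi i) (hi j) (hij i j)
  have hmean : ∀ i j, ∫ ω, gpEstimator (fun n => x n ω) i j ∂P = gpCumulant D c b i j :=
    fun i j => by
      rw [integral_gpEstimator hN hx hind (hi i) (hi j) (hij i j), gpCumulant_apply_eq hD hc hb]
  have hint : ∀ i j, Integrable
      (fun ω => (gpEstimator (fun n => x n ω) i j - gpCumulant D c b i j) ^ 2) P := fun i j =>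
    ((hmem i j).sub (memLp_const _)).integrable_sq
  have hvar : ∀ i j, ∫ ω, (gpEstimator (fun n => x n ω) i j - gpCumulant D c b i j) ^ 2 ∂P =
      Var[fun ω => gpEstimator (fun n => x n ω) i j; P] := fun i j => by
    rw [variance_eq_integral (hmem i j).1.aemeasurable, hmean]
  simp_rw [Matrix.frobenius_norm_sq_eq_sum, Matrix.sub_apply]
  refine ⟨integrable_finsetSum _ fun i _ => integrable_finsetSum _ fun j _ => hint i j, ?_⟩
  rw [integral_finsetSum _ fun i _ => integrable_finsetSum _ fun j _ => hint i j]
  simp_rw [fun i => integral_finsetSum Finset.univ fun j _ => hint i j, hvar]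
  have hC : 0 < ∑ k, c k :=
    Finset.sum_pos (fun k _ => hc k) ⟨⟨0, hK⟩, Finset.mem_univ _⟩
  calc ∑ i, ∑ j, Var[fun ω => gpEstimator (fun n => x n ω) i j; P]
      ≤ ∑ i, ∑ j, 16 / (N : ℝ) * (∫ x, (pairCount x i j : ℝ) ^ 2 ∂gpLaw D c b
        + (∫ x, (x i : ℝ) ^ 2 ∂gpLaw D c b) * ∫ x, (x j : ℝ) ^ 2 ∂gpLaw D c b) :=
        Finset.sum_le_sum fun i _ => Finset.sum_le_sum fun j _ =>
          variance_gpEstimator_le hN hx hind (hi i) (hi j) (hij i j)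
    _ = 16 / (N : ℝ) * (∑ i, ∑ j, ∫ x, (pairCount x i j : ℝ) ^ 2 ∂gpLaw D c b
        + (∑ i, ∫ x, (x i : ℝ) ^ 2 ∂gpLaw D c b) ^ 2) := by
        rw [pow_two (∑ i, _), Finset.sum_mul_sum]
        simp only [← Finset.mul_sum, Finset.sum_add_distrib]
    _ ≤ 16 / (N : ℝ) * _ := by
        refine mul_le_mul_of_nonneg_left ?_ (by positivity)
        refine le_trans (add_le_add (sum_integral_pairCount_sq_gpLaw_le hD hc hb)
          (pow_le_pow_left₀ (Finset.sum_nonneg fun i _ => integral_nonneg fun _ => sq_nonneg _)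
            (sum_integral_apply_sq_gpLaw_le hD hc hb) 2)) ?_
        exact gamma_moment_bound hC hb (maxTopicNormSq_nonneg D) rfl (gpMeanLength_eq hD hc hb) rfl

end Main

theorem proposition1 :
    ∃ C : ℝ, 0 < C ∧
      ∀ (K M N : ℕ) (_ : 1 ≤ K) (_ : 2 ≤ N)
        (D : Matrix (Fin M) (Fin K) ℝ) (_ : ∀ k, D.col k ∈ stdSimplex ℝ (Fin M))
        (c : Fin K → ℝ) (_ : ∀ k, 0 < c k) (b : ℝ) (_ : 0 < b)
        (Ω : Type*) [MeasurableSpace Ω] (P : Measure Ω) [IsProbabilityMeasure P]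
        (x : Fin N → Ω → Fin M → ℕ)
        (_ : ∀ n, HasLaw (x n) (gpLaw D c b) P) (_ : iIndepFun x P),
        (∀ i j, Integrable (fun ω => gpEstimator (fun n => x n ω) i j) P ∧
          ∫ ω, gpEstimator (fun n => x n ω) i j ∂P = gpCumulant D c b i j) ∧
        Integrable (fun ω => ‖gpEstimator (fun n => x n ω) - gpCumulant D c b‖ ^ 2) P ∧
        ∫ ω, ‖gpEstimator (fun n => x n ω) - gpCumulant D c b‖ ∂P ≤
          √(∫ ω, ‖gpEstimator (fun n => x n ω) - gpCumulant D c b‖ ^ 2 ∂P) ∧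
        √(∫ ω, ‖gpEstimator (fun n => x n ω) - gpCumulant D c b‖ ^ 2 ∂P) ≤
          (C / √(cappedShape c ^ 3)) * ((1 / √(N : ℝ)) *
            max (maxTopicNormSq D * gpMeanLength D c b ^ 2)
              (cappedShape c * gpMeanLength D c b)) := by
  -- The squared error carries `16 * 113 = 1808`, and `43 ^ 2 = 1849`.
  refine ⟨43, by norm_num, ?_⟩
  intro K M N hK hN D hD c hc b hb Ω _ P _ x hx hind
  have hi := memLp_apply_gpLaw hD hc hb
  have hij := memLp_pairCount_gpLaw hD hc hb
  have hmem := fun i j => memLp_gpEstimator hN hx hind (hi i) (hi j) (hij i j)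
  obtain ⟨hint, hle⟩ := integral_norm_sub_sq_le hK hN hD hc hb hx hind
  refine ⟨fun i j => ⟨(hmem i j).integrable one_le_two, ?_⟩, hint, ?_, ?_⟩
  · rw [integral_gpEstimator hN hx hind (hi i) (hi j) (hij i j), gpCumulant_apply_eq hD hc hb]
  · have hmeas : AEStronglyMeasurable
        (fun ω => ‖gpEstimator (fun n => x n ω) - gpCumulant D c b‖) P := by
      -- Measurability of the norm is recovered from that of its square.
      refine (hint.1.aemeasurable.sqrt.aestronglyMeasurable).congr (ae_of_all _ fun ω => ?_)
      exact Real.sqrt_sq (norm_nonneg _)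
    have hL2 := (memLp_two_iff_integrable_sq hmeas).2 hint
    refine Real.le_sqrt_of_sq_le ?_
    -- Jensen's inequality in the form `0 ≤ Var ‖Ŝ - S‖`.
    have := variance_nonneg (fun ω => ‖gpEstimator (fun n => x n ω) - gpCumulant D c b‖) P
    rw [variance_eq_sub hL2] at this
    simpa using this
  · have hs : 0 < cappedShape c :=
      lt_min one_pos (Finset.sum_pos (fun k _ => hc k) ⟨⟨0, hK⟩, Finset.mem_univ _⟩)
    have hN0 : (0 : ℝ) < N := by exact_mod_cast (by omega : 0 < N)
    have hm : 0 ≤ max (maxTopicNormSq D * gpMeanLength D c b ^ 2)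
        (cappedShape c * gpMeanLength D c b) :=
      le_max_of_le_left (mul_nonneg (maxTopicNormSq_nonneg D) (sq_nonneg _))
    refine (Real.sqrt_le_left (by positivity)).2 (hle.trans ?_)
    rw [mul_pow, mul_pow, div_pow, div_pow, Real.sq_sqrt (by positivity), Real.sq_sqrt hN0.le]
    generalize max (maxTopicNormSq D * gpMeanLength D c b ^ 2)
        (cappedShape c * gpMeanLength D c b) = m
    rw [show (16 : ℝ) / N * (113 * m ^ 2 / cappedShape c ^ 3) =
      1808 * (m ^ 2 / (N * cappedShape c ^ 3)) by ring,
      show (43 : ℝ) ^ 2 / cappedShape c ^ 3 * (1 ^ 2 / N * m ^ 2) =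
      1849 * (m ^ 2 / (N * cappedShape c ^ 3)) by field_simp; ring]
    gcongr
    norm_num
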